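/- Let $(R,\mathfrak m,k)$ be a commutative Noetherian Cohen–Macaulay local ring of dimension $d$ with infinite residue field $k$, and let $\omega$ be a canonical module of $R$, i.e. a maximal Cohen–Macaulay $R$-module of finite injective dimension with $\dim_k\operatorname{Ext}^d_R(k,\omega)=1$. Let $\omega^*(\omega)$ be the trace ideal of $\omega$, the ideal of $R$ generated by all $f(x)$ with $f\in\operatorname{Hom}_R(\omega,R)$ and $x\in\omega$. A parameter ideal is an ideal generated by a system of parameters, i.e. by $d$ elements that generate an $\mathfrak m$-primary ideal. Let $\Lambda$ be any set of prime ideals of $R$, all different from $\mathfrak m$, that is finite, or that is countable in case $R$ is $\mathfrak m$-adically complete or $k$ is uncountable. Consider the following conditions: 1. $\mathfrak m\subseteq\omega^*(\omega)$. 2. For every parameter ideal $K$ and every ideal $I\supseteq K$, one has $K:(K:I)\subseteq I:\mathfrak m$. 3. For every parameter ideal $K$ with $K\not\subseteq\bigcup_{\mathfrak p\in\Lambda}\mathfrak p$ and every ideal $I\supseteq K$, one has $K:(K:I)\subseteq I:\mathfrak m$. Then (1) implies (2), and (2) implies (3) for every such $\Lambda$. -/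

import Mathlib

open IsLocalRing CategoryTheory

universe u

/-- A nonzero finitely generated module over a local ring `R` of dimension `d` is maximal
Cohen-Macaulay if there is an `M`-regular sequence of length `d` in the maximal ideal. -/
structure IsMaximalCohenMacaulay (R : Type u) [CommRing R] [IsLocalRing R]
    (M : Type u) [AddCommGroup M] [Module R M] : Prop where
  finite : Module.Finite R M
  nontrivial : Nontrivial M
  exists_isRegular : ∃ rs : List R, (∀ r ∈ rs, r ∈ maximalIdeal R) ∧
    ((rs.length : ℕ∞) : WithBot ℕ∞) = ringKrullDim R ∧ RingTheory.Sequence.IsRegular M rs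

/-- A local ring is Cohen-Macaulay if it is maximal Cohen-Macaulay as a module over itself. -/
def IsCohenMacaulayLocal (R : Type u) [CommRing R] [IsLocalRing R] : Prop :=
  IsMaximalCohenMacaulay R R

/-- A canonical module of a Cohen-Macaulay local ring with residue field `k`: a maximal
Cohen-Macaulay module of finite injective dimension and of type one, that is, with
`Ext^d(k, ω)` one-dimensional over `k` for `d = dim R`. -/
structure IsCanonicalModule (R : Type u) [CommRing R] [IsLocalRing R]
    (ω : Type u) [AddCommGroup ω] [Module R ω] : Prop where
  isMaximalCohenMacaulay : IsMaximalCohenMacaulay R ω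
  finite_injectiveDimension : ∃ n : ℕ, HasInjectiveDimensionLE (ModuleCat.of R ω) n
  type_eq_one : ∀ d : ℕ, ((d : ℕ∞) : WithBot ℕ∞) = ringKrullDim R →
    Nonempty (Abelian.Ext (ModuleCat.of R (ResidueField R)) (ModuleCat.of R ω) d
      ≃ₗ[R] ResidueField R)

/-- The trace ideal `M^*(M)`: the ideal generated by all `f x` with `f : M → R` linear and
`x ∈ M`. -/
def traceIdeal (R : Type u) [CommRing R] (M : Type u) [AddCommGroup M] [Module R M] : Ideal R :=
  Ideal.span {a : R | ∃ (f : M →ₗ[R] R) (x : M), f x = a}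

/-- `x₁, …, x_d` is a system of parameters of the local ring `R`: `d = dim R`, and the ideal
`(x₁, …, x_d)` is primary to the maximal ideal, i.e. its radical is the maximal ideal. -/
def IsSystemOfParameters {R : Type u} [CommRing R] [IsLocalRing R] {d : ℕ} (x : Fin d → R) :
    Prop :=
  ((d : ℕ∞) : WithBot ℕ∞) = ringKrullDim R ∧
    (Ideal.span (Set.range x)).radical = maximalIdeal R

/-- `K` is generated by a system of parameters. -/
def IsParameterIdeal {R : Type u} [CommRing R] [IsLocalRing R] (K : Ideal R) : Prop :=
  ∃ (d : ℕ) (x : Fin d → R), IsSystemOfParameters x ∧ K = Ideal.span (Set.range x)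

/-- For every ideal `I ⊇ K` one has `K : (K : I) ⊆ I : m`. -/
def AlmostDualModulo {R : Type u} [CommRing R] [IsLocalRing R] (K : Ideal R) : Prop :=
  ∀ I : Ideal R, K ≤ I →
    K.colon (K.colon (I : Set R) : Set R) ≤ I.colon (maximalIdeal R : Set R)

/-- The sets of primes that may be avoided: none of the primes is the maximal ideal, and the set
is finite, or countable in case `R` is complete or its residue field is uncountable. -/
def IsAvoidablePrimeSet {R : Type u} [CommRing R] [IsLocalRing R] (Λ : Set (Ideal R)) : Prop :=
  (∀ p ∈ Λ, p.IsPrime ∧ p ≠ maximalIdeal R) ∧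
    (Λ.Finite ∨
      (Λ.Countable ∧ (IsAdicComplete (maximalIdeal R) R ∨ Uncountable (ResidueField R))))

/-- `K` is general with respect to `Λ`: it contains an element outside all members of `Λ`. -/
def IsGeneralFor {R : Type u} [CommRing R] (Λ : Set (Ideal R)) (K : Ideal R) : Prop :=
  ¬ ((K : Set R) ⊆ ⋃ p ∈ Λ, (p : Set R))

/-! Let `K` be a parameter ideal and `E = ω/Kω`. Over `R/K`, `E` acts as the injective hull of `k`,
so its endomorphisms are homotheties (`IsDualizingModulo.exists_eq_smul`). If `a ∈ K : (K : I)` and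
`aE ⊄ IE`, some map `E/IE → E` does not kill the image of `aE`. Composed with `E → E/IE` it is
multiplication by some `s` with `sI ⊆ K`, so `as ∈ K` kills `E`, a contradiction. Hence `aω ⊆ Iω`,
and applying maps `ω → R` shows that `a` multiplies the trace ideal into `I`. This gives (1) ⇒ (2);
(2) ⇒ (3) only restricts the class of `K`.

That `E` is dualizing comes from comparing `Hom(N, E)` with `Ext^d(N, ω)`. Parameters are regular on
`ω` and `R`. The type of `ω` bounds the socle of `E`, and `Ext^{d+1}(-, ω) = 0` on modules of finite
length makes maps extend. -/

/-! ### Depth, associated primes and regular sequences -/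

section Depth

open Abelian RingTheory.Sequence Pointwise

variable {R : Type u} [CommRing R]

/-- Vanishing of `Ext` in degrees below `n + 1` passes to degrees below `n` for the quotient by a
regular element. -/
lemma subsingleton_ext_quotSMulTop (N : ModuleCat.{u} R) {M : Type u} [AddCommGroup M] [Module R M]
    {r : R} (hr : IsSMulRegular M r) {n : ℕ}
    (h : ∀ i < n + 1, Subsingleton (Ext N (ModuleCat.of R M) i)) :
    ∀ i < n, Subsingleton (Ext N (ModuleCat.of R (QuotSMulTop r M)) i) := by
  intro i hi
  refine subsingleton_of_forall_eq 0 fun x => ?_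
  have hS := IsSMulRegular.smulShortComplex_shortExact (M := ModuleCat.of R M) hr
  obtain ⟨y, hy⟩ := Ext.covariant_sequence_exact₃ N hS x rfl
    ((h (i + 1) (by omega)).elim _ _)
  rw [← hy, (h i (by omega)).elim y 0]
  exact Ext.zero_comp ..

variable [IsLocalRing R] [IsNoetherianRing R]

/-- The depth of a finitely generated module is at most the dimension of `R ⧸ p` for each of its
associated primes `p`. -/
lemma le_ringKrullDim_quotient_of_isAssociatedPrime (n : ℕ) (M : Type u) [AddCommGroup M]
    [Module R M] [Module.Finite R M]
    (h : ∀ i < n, Subsingleton (Ext (ModuleCat.of R (ResidueField R)) (ModuleCat.of R M) i))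
    {p : Ideal R} (hp : IsAssociatedPrime p M) : (n : WithBot ℕ∞) ≤ ringKrullDim (R ⧸ p) := by
  induction n generalizing M p with
  | zero =>
    have := hp.isPrime
    exact ringKrullDim_nonneg_of_nontrivial
  | succ n ih =>
    have hprime := hp.isPrime
    have h0 : Subsingleton (ResidueField R →ₗ[R] M) :=
      have := h 0 n.succ_pos
      ((Ext.addEquiv₀ (X := ModuleCat.of R (ResidueField R)) (Y := ModuleCat.of R M)).trans
        ModuleCat.homAddEquiv).symm.subsingleton
    have : Module.Finite R (ResidueField R) :=
      Module.Finite.of_surjective (Algebra.linearMap R (ResidueField R)) residue_surjective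
    obtain ⟨r, hrk, hr⟩ := IsSMulRegular.subsingleton_linearMap_iff.mp h0
    have hrm : r ∈ maximalIdeal R := by
      have := Module.mem_annihilator.mp hrk 1
      rwa [Algebra.smul_def, mul_one, ResidueField.algebraMap_eq, residue_eq_zero_iff] at this
    obtain ⟨-, x, hx⟩ := isAssociatedPrime_iff.mp hp
    have hpx : ∀ a, a ∈ p ↔ a • x = 0 := fun a => by rw [hx]; simp
    have hx0 : x ≠ 0 := fun h0 => hprime.ne_top <|
      (Ideal.eq_top_iff_one _).mpr ((hpx 1).mpr (by simp [h0]))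
    have hrp : r ∉ p := fun hmem => hx0 (hr (by simpa using (hpx r).mp hmem))
    -- the elements killed by `p` are not all divisible by `r`
    let T : Submodule R M :=
      { carrier := {m | ∀ a ∈ p, a • m = 0}
        add_mem' := fun {u v} hu hv a ha => by simp [hu a ha, hv a ha]
        zero_mem' := fun a _ => smul_zero a
        smul_mem' := fun c m hm a ha => by rw [smul_comm, hm a ha, smul_zero] }
    obtain ⟨m, hmT, hm⟩ : ∃ m ∈ T, m ∉ r • (⊤ : Submodule R M) := by
      by_contra! hcon
      -- As `r` is regular, `rm' ∈ T` forces `m' ∈ T`. So `T ⊆ rM` would give `T = rT`, and Nakayama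
      -- would give `T = 0`, although `x ∈ T`.
      have hT : T ≤ (Ideal.span {r}) • T := by
        intro m hm
        obtain ⟨m', -, rfl⟩ := Submodule.mem_smul_pointwise_iff_exists _ _ _ |>.mp (hcon m hm)
        refine Submodule.smul_mem_smul (Ideal.mem_span_singleton_self r) fun a ha => ?_
        refine hr ?_
        simpa [smul_comm r a] using hm a ha
      have : T = ⊥ := Submodule.eq_bot_of_le_smul_of_le_jacobson_bot _ T
        (IsNoetherian.noetherian T) hT
        ((Ideal.span_singleton_le_iff_mem _).mpr (by rwa [jacobson_eq_maximalIdeal _ bot_ne_top]))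
      exact hx0 ((Submodule.eq_bot_iff T).mp this x fun a ha => (hpx a).mp ha)
    -- The class of `m` in `M/rM` is nonzero and killed by `p` and `r`. So `q` contains both, and
    -- since `r ∉ p` the dimension drops from `R/p` to `R/q`.
    obtain ⟨q, hq, hmq⟩ := exists_le_isAssociatedPrime_of_isNoetherianRing R
      (Submodule.Quotient.mk m : QuotSMulTop r M)
      (fun h0 => hm ((Submodule.Quotient.mk_eq_zero _).mp h0))
    have hpq : p ≤ q := fun a ha => hmq (by
      simp only [Submodule.mem_colon_singleton, Submodule.mem_bot]
      rw [← Submodule.Quotient.mk_smul, hmT a ha, Submodule.Quotient.mk_zero])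
    have hrq : r ∈ q := hmq (by
      simp only [Submodule.mem_colon_singleton, Submodule.mem_bot]
      rw [← Submodule.Quotient.mk_smul, Submodule.Quotient.mk_eq_zero]
      exact Submodule.smul_mem_pointwise_smul _ _ _ trivial)
    have := ih (QuotSMulTop r M) (subsingleton_ext_quotSMulTop _ hr h) hq
    refine le_trans ?_ (ringKrullDim_succ_le_of_surjective (Ideal.Quotient.factor hpq)
      (Ideal.Quotient.factor_surjective hpq) (r := Ideal.Quotient.mk p r) ?_ ?_)
    · push_cast
      gcongr
    · exact mem_nonZeroDivisors_of_ne_zero (by rwa [Ne, Ideal.Quotient.eq_zero_iff_mem])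
    · simpa [Ideal.Quotient.eq_zero_iff_mem] using hrq

/-- A Noetherian local ring has dimension at most the number of generators of an ideal primary to
the maximal ideal; version for a quotient ring. -/
lemma ringKrullDim_quotient_le_length {p : Ideal R} [p.IsPrime] (rs : List R)
    (h : maximalIdeal R ≤ (p ⊔ Ideal.ofList rs).radical) (mem : ∀ r ∈ rs, r ∈ maximalIdeal R) :
    ringKrullDim (R ⧸ p) ≤ rs.length := by
  classical
  have : IsLocalRing (R ⧸ p) := .of_surjective' _ Ideal.Quotient.mk_surjective
  have hmap : (maximalIdeal (R ⧸ p)).comap (Ideal.Quotient.mk p) = maximalIdeal R :=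
    eq_maximalIdeal (Ideal.comap_isMaximal_of_surjective _ Ideal.Quotient.mk_surjective)
  rw [← maximalIdeal_height_eq_ringKrullDim]
  let s : Finset (R ⧸ p) := (rs.map (Ideal.Quotient.mk p)).toFinset
  have hs : Ideal.span (s : Set (R ⧸ p)) = (Ideal.ofList rs).map (Ideal.Quotient.mk p) := by
    rw [Ideal.map_ofList]
    simp [s, Ideal.ofList]
  have hmin : maximalIdeal (R ⧸ p) ∈ (Ideal.span (s : Set (R ⧸ p))).minimalPrimes := by
    rw [hs]
    refine ⟨⟨inferInstance, ?_⟩, fun J ⟨hJ, hle⟩ _ => ?_⟩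
    · rw [Ideal.map_le_iff_le_comap, hmap, Ideal.ofList, Ideal.span_le]
      exact mem
    · have : maximalIdeal R ≤ J.comap (Ideal.Quotient.mk p) := by
        refine h.trans ((Ideal.IsPrime.radical_le_iff inferInstance).mpr (sup_le ?_ ?_))
        · intro a ha
          simp [Ideal.Quotient.eq_zero_iff_mem.mpr ha]
        · exact Ideal.map_le_iff_le_comap.mp hle
      rw [← hmap] at this
      exact (Ideal.comap_le_comap_iff_of_surjective _ Ideal.Quotient.mk_surjective _ _).mp this
  have h1 := Ideal.height_le_card_of_mem_minimalPrimes_span_finset hmin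
  have h2 : (s.card : ℕ∞) ≤ rs.length := by
    exact_mod_cast (List.toFinset_card_le _).trans (by simp)
  exact_mod_cast h1.trans h2

/-- If the depth of `M` is at least the length of `rs`, and `rs` generates an ideal primary to the
maximal ideal modulo the annihilator of `M`, then `rs` is regular on `M`. -/
lemma isWeaklyRegular_of_maximalIdeal_le_radical (rs : List R) (M : Type u) [AddCommGroup M]
    [Module R M] [Module.Finite R M]
    (h : ∀ i < rs.length,
      Subsingleton (Ext (ModuleCat.of R (ResidueField R)) (ModuleCat.of R M) i))
    (mem : ∀ r ∈ rs, r ∈ maximalIdeal R)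
    (hrad : maximalIdeal R ≤ (Module.annihilator R M ⊔ Ideal.ofList rs).radical) :
    IsWeaklyRegular M rs := by
  induction rs generalizing M with
  | nil => exact .nil _ _
  | cons r rs ih =>
    simp only [List.mem_cons, forall_eq_or_imp] at mem
    have hr : IsSMulRegular M r := by
      -- A zero divisor `r` lies in an associated prime `p`. Then `rs` alone generates an ideal
      -- primary to the maximal ideal modulo `p`, so `dim R/p ≤ rs.length`, which is less than the
      -- depth.
      by_contra hr
      have : r ∈ ⋃ p ∈ associatedPrimes R M, (p : Set R) := by
        rw [biUnion_associatedPrimes_eq_zero_divisors]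
        by_contra hcon
        refine hr ((isSMulRegular_iff_right_eq_zero_of_smul).mpr fun x hx => ?_)
        by_contra hx0
        exact hcon ⟨x, hx0, hx⟩
      simp only [Set.mem_iUnion, SetLike.mem_coe] at this
      obtain ⟨p, hp, hrp⟩ := this
      have hprime : p.IsPrime := hp.1
      have h1 := le_ringKrullDim_quotient_of_isAssociatedPrime _ M h hp
      have hann : Module.annihilator R M ≤ p := by
        simpa [Submodule.annihilator_top] using hp.annihilator_le
      have h2 := ringKrullDim_quotient_le_length (p := p) rs
        (hrad.trans (Ideal.radical_mono (sup_le (hann.trans le_sup_left) (by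
          rw [Ideal.ofList_cons]
          exact sup_le_sup_right ((Ideal.span_singleton_le_iff_mem _).mpr hrp) _)))) mem.2
      have := h1.trans h2
      simp only [List.length_cons] at this
      have : rs.length + 1 ≤ rs.length := by exact_mod_cast this
      omega
    refine .cons hr (ih (QuotSMulTop r M) (subsingleton_ext_quotSMulTop _ hr h) mem.2 ?_)
    refine hrad.trans (Ideal.radical_mono (sup_le ?_ ?_))
    · exact (LinearMap.annihilator_le_of_surjective _ (Submodule.mkQ_surjective _)).trans
        le_sup_left
    · rw [Ideal.ofList_cons]
      exact sup_le_sup_right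
        ((Ideal.span_singleton_le_iff_mem _).mpr (QuotSMulTop.mem_annihilator M r)) _

end Depth

/-! ### Vanishing of Ext on modules of finite length -/

section FiniteLengthExt

open Abelian RingTheory.Sequence Pointwise

variable {R : Type u} [CommRing R]

lemma LinearEquiv.subsingleton_ext {N N' : Type u} [AddCommGroup N] [Module R N] [AddCommGroup N']
    [Module R N'] (e : N ≃ₗ[R] N') (M : ModuleCat.{u} R) (i : ℕ)
    (h : Subsingleton (Ext (ModuleCat.of R N') M i)) :
    Subsingleton (Ext (ModuleCat.of R N) M i) := by
  refine subsingleton_of_forall_eq 0 fun x => ?_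
  have hx : (Ext.mk₀ e.toModuleIso.hom).comp ((Ext.mk₀ e.toModuleIso.inv).comp x (zero_add i))
      (zero_add i) = x := by
    rw [Ext.mk₀_comp_mk₀_assoc, Iso.hom_inv_id, Ext.mk₀_id_comp]
  rw [← hx, h.elim ((Ext.mk₀ e.toModuleIso.inv).comp x (zero_add i)) 0, Ext.comp_zero]

/-- The short complex `0 → N → M → M ⧸ N → 0`. -/
noncomputable abbrev Submodule.quotientShortComplex {M : Type u} [AddCommGroup M] [Module R M]
    (N : Submodule R M) : ShortComplex (ModuleCat.{u} R) :=
  ModuleCat.shortComplexOfCompEqZero N.subtype N.mkQ (by ext; simp)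

lemma Submodule.quotientShortComplex_shortExact {M : Type u} [AddCommGroup M] [Module R M]
    (N : Submodule R M) : N.quotientShortComplex.ShortExact where
  exact := ModuleCat.shortComplex_exact _ (LinearMap.exact_subtype_mkQ N)
  mono_f := (ModuleCat.mono_iff_injective _).mpr N.injective_subtype
  epi_g := (ModuleCat.epi_iff_surjective _).mpr N.mkQ_surjective

variable [IsLocalRing R]

lemma IsSimpleModule.nonempty_linearEquiv_residueField (N : Type*) [AddCommGroup N] [Module R N]
    [IsSimpleModule R N] : Nonempty (N ≃ₗ[R] ResidueField R) := by
  obtain ⟨I, hI, ⟨e⟩⟩ := isSimpleModule_iff_quot_maximal.mp ‹IsSimpleModule R N›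
  obtain rfl := eq_maximalIdeal hI
  exact ⟨e⟩

/-- Dévissage: every composition factor is the residue field, and `Ext` of the middle term of a
short exact sequence vanishes when both outer ones do. -/
lemma subsingleton_ext_of_isFiniteLength (M : ModuleCat.{u} R) (i : ℕ)
    (h : Subsingleton (Ext (ModuleCat.of R (ResidueField R)) M i))
    {N : Type u} [AddCommGroup N] [Module R N] (hN : IsFiniteLength R N) :
    Subsingleton (Ext (ModuleCat.of R N) M i) := by
  induction hN with
  | @of_subsingleton N _ _ _ =>
    refine subsingleton_of_forall_eq 0 fun x => ?_
    have : 𝟙 (ModuleCat.of R N) = 0 := by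
      ext y
      exact Subsingleton.elim _ _
    rw [← Ext.mk₀_id_comp x, this, Ext.mk₀_zero, Ext.zero_comp]
  | @of_simple_quotient L _ _ N _ _ ih =>
    obtain ⟨e⟩ := IsSimpleModule.nonempty_linearEquiv_residueField (R := R) (L ⧸ N)
    have hQ := e.subsingleton_ext M i h
    refine subsingleton_of_forall_eq 0 fun x => ?_
    obtain ⟨y, hy⟩ := Ext.contravariant_sequence_exact₂ N.quotientShortComplex_shortExact M x
      (ih.elim _ _)
    rw [← hy, hQ.elim y 0]
    exact Ext.comp_zero ..

/-- A nonzero module of finite length has a submodule isomorphic to the residue field. -/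
lemma IsFiniteLength.exists_submodule_linearEquiv_residueField {N : Type*} [AddCommGroup N]
    [Module R N] [Nontrivial N] (hN : IsFiniteLength R N) :
    ∃ S : Submodule R N, Nonempty (S ≃ₗ[R] ResidueField R) := by
  obtain ⟨_, _⟩ := isFiniteLength_iff_isNoetherian_isArtinian.mp hN
  obtain ⟨S, hS⟩ := IsAtomic.exists_atom (Submodule R N)
  have := isSimpleModule_iff_isAtom.mpr hS
  exact ⟨S, IsSimpleModule.nonempty_linearEquiv_residueField _⟩

/-- If a nonzero module of finite length has no `Ext` into `M` above degree `d`, and `M` has finite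
injective dimension, then the residue field has no `Ext` into `M` above degree `d` either. -/
lemma subsingleton_ext_residueField_of_lt (M : ModuleCat.{u} R) {n d : ℕ}
    (hM : HasInjectiveDimensionLE M n) {Q : Type u} [AddCommGroup Q] [Module R Q] [Nontrivial Q]
    (hQ : IsFiniteLength R Q) (h : ∀ i, d < i → Subsingleton (Ext (ModuleCat.of R Q) M i))
    (i : ℕ) (hi : d < i) : Subsingleton (Ext (ModuleCat.of R (ResidueField R)) M i) := by
  obtain ⟨S, ⟨e⟩⟩ := hQ.exists_submodule_linearEquiv_residueField
  -- Descending induction on the degree `i`, starting above the injective dimension; `j` bounds how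
  -- far `i` lies below that range.
  suffices ∀ j i, n < i + j → d < i →
      Subsingleton (Ext (ModuleCat.of R (ResidueField R)) M i) from
    this (n + 1) i (by omega) hi
  intro j
  induction j with
  | zero =>
    intro i hi _
    exact HasInjectiveDimensionLT.subsingleton M (n + 1) i (by omega) _
  | succ j ih =>
    intro i hi hd
    refine e.symm.subsingleton_ext M i (subsingleton_of_forall_eq 0 fun x => ?_)
    -- With `S ≅ k` inside `Q`, `Ext^i(S, M)` sits between `Ext^i(Q, M) = 0` and `Ext^{i+1}(Q/S,
    -- M)`, which vanishes by induction and dévissage.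
    have hS := subsingleton_ext_of_isFiniteLength M (1 + i) (ih (1 + i) (by omega) (by omega))
      (hQ.of_surjective S.mkQ_surjective)
    obtain ⟨y, hy⟩ := Ext.contravariant_sequence_exact₁ S.quotientShortComplex_shortExact M x rfl
      (hS.elim _ _)
    rw [← hy, (h i hd).elim y 0]
    exact Ext.comp_zero ..

end FiniteLengthExt

/-! ### Dimension shifting along a regular sequence -/

section Shift

open Abelian RingTheory.Sequence Pointwise

variable {R : Type u} [CommRing R]

/-- Let `rs` be regular on `M` and kill `N`. Then the maps `N' → M ⧸ (rs) M` extend along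
`f : N' → N` if the classes in `Ext N' M rs.length` do. -/
lemma exists_comp_eq_of_ext_surjective (rs : List R) (M : Type u) [AddCommGroup M] [Module R M]
    (reg : IsWeaklyRegular M rs) {N' N : ModuleCat.{u} R} (f : N' ⟶ N)
    (hkill : ∀ r ∈ rs, r ∈ Module.annihilator R N)
    (hvan : ∀ i < rs.length, Subsingleton (Ext N' (ModuleCat.of R M) i))
    (hsurj : ∀ α : Ext N' (ModuleCat.of R M) rs.length,
      ∃ β : Ext N (ModuleCat.of R M) rs.length, (Ext.mk₀ f).comp β (zero_add _) = α)
    (g : N' →ₗ[R] M ⧸ (Ideal.ofList rs • ⊤ : Submodule R M)) :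
    ∃ h : N →ₗ[R] M ⧸ (Ideal.ofList rs • ⊤ : Submodule R M), h ∘ₗ f.hom = g := by
  induction rs generalizing M with
  | nil =>
    let e : (M ⧸ (Ideal.ofList ([] : List R) • ⊤ : Submodule R M)) ≃ₗ[R] M :=
      Submodule.quotEquivOfEqBot _ (by simp)
    obtain ⟨β, hβ⟩ := hsurj (Ext.mk₀ (ModuleCat.ofHom (e.toLinearMap ∘ₗ g)))
    obtain ⟨b, rfl⟩ := (Ext.mk₀_bijective _ _).2 β
    rw [Ext.mk₀_comp_mk₀] at hβ
    have hb := (Ext.mk₀_bijective _ _).1 hβ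
    refine ⟨e.symm.toLinearMap ∘ₗ b.hom, ?_⟩
    ext x
    have := congrArg (fun k => e.symm (k.hom x)) hb
    simpa using this
  | cons r rs ih =>
    rw [isWeaklyRegular_cons_iff] at reg
    simp only [List.mem_cons, forall_eq_or_imp] at hkill
    let e := Submodule.quotOfListConsSMulTopEquivQuotSMulTopInner M r rs
    have hS := IsSMulRegular.smulShortComplex_shortExact (M := ModuleCat.of R M) reg.1
    -- Lift the image of `α` under the connecting map to `β` on `N`. As `r` kills `N`, `rβ = 0`, so
    -- `β` comes from some `γ`. The restriction of `γ` to `N'` equals `α` because the connecting map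
    -- is injective on `N'`.
    have key (α : Ext N' ((ModuleCat.of R M).smulShortComplex r).X₃ rs.length) :
        ∃ β : Ext N ((ModuleCat.of R M).smulShortComplex r).X₃ rs.length,
          (Ext.mk₀ f).comp β (zero_add _) = α := by
      obtain ⟨β, hβ⟩ := hsurj (Ext.comp (b := 1) α hS.extClass rfl)
      have hrβ : β.comp (Ext.mk₀ (ModuleCat.smulShortComplex (ModuleCat.of R M) r).f)
          (add_zero _) = 0 := by
        have := Ext.postcomp_smul_id_eq_zero_of_mem_annihilator (M := ModuleCat.of R M)
          hkill.1 (rs.length + 1)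
        exact congrArg (fun k => k.hom β) this
      obtain ⟨γ, hγ⟩ := Ext.covariant_sequence_exact₁ N hS β hrβ rfl
      refine ⟨γ, ?_⟩
      rw [← sub_eq_zero]
      obtain ⟨y, hy⟩ := Ext.covariant_sequence_exact₃ N' hS
        ((Ext.mk₀ f).comp γ (zero_add _) - α) (n₁ := rs.length + 1) rfl (by
          rw [sub_eq_add_neg, Ext.add_comp, Ext.neg_comp, ← sub_eq_add_neg, sub_eq_zero]
          rw [Ext.comp_assoc _ _ _ (zero_add _) rfl (by omega), hγ]
          exact hβ)
      rw [← hy, (hvan rs.length (by simp)).elim y 0]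
      exact Ext.zero_comp ..
    obtain ⟨h, hh⟩ := ih (QuotSMulTop r M) reg.2 hkill.2
      (subsingleton_ext_quotSMulTop _ reg.1 hvan) key (e.toLinearMap ∘ₗ g)
    refine ⟨e.symm.toLinearMap ∘ₗ h, ?_⟩
    rw [LinearMap.comp_assoc, hh]
    ext x
    simp

/-- If `rs` is regular on `M`, and `N` has no `Ext` into `M` below degree `rs.length`, then
`Hom(N, M ⧸ (rs) M)` embeds in `Ext N M rs.length`. -/
lemma exists_injective_hom_ext (rs : List R) (M : Type u) [AddCommGroup M] [Module R M]
    (reg : IsWeaklyRegular M rs) (N : ModuleCat.{u} R)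
    (hvan : ∀ i < rs.length, Subsingleton (Ext N (ModuleCat.of R M) i)) :
    ∃ φ : (N →ₗ[R] M ⧸ (Ideal.ofList rs • ⊤ : Submodule R M)) →ₗ[R]
      Ext N (ModuleCat.of R M) rs.length, Function.Injective φ := by
  induction rs generalizing M with
  | nil =>
    let e : (M ⧸ (Ideal.ofList ([] : List R) • ⊤ : Submodule R M)) ≃ₗ[R] M :=
      Submodule.quotEquivOfEqBot _ (by simp)
    refine ⟨
      { toFun := fun g => Ext.mk₀ (ModuleCat.ofHom (e.toLinearMap ∘ₗ g))
        map_add' := fun g g' => ?_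
        map_smul' := fun c g => ?_ }, fun g g' h => ?_⟩
    · rw [LinearMap.comp_add, ModuleCat.ofHom_add, Ext.mk₀_add]
    · rw [LinearMap.comp_smul, RingHom.id_apply, ← Ext.mk₀_smul]
      rfl
    · have := (Ext.mk₀_bijective _ _).1 h
      ext x
      exact e.injective (congrArg (fun k => k.hom x) this)
  | cons r rs ih =>
    rw [isWeaklyRegular_cons_iff] at reg
    let e := Submodule.quotOfListConsSMulTopEquivQuotSMulTopInner M r rs
    have hS := IsSMulRegular.smulShortComplex_shortExact (M := ModuleCat.of R M) reg.1
    obtain ⟨φ, hφ⟩ := ih (QuotSMulTop r M) reg.2 (subsingleton_ext_quotSMulTop _ reg.1 hvan)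
    let δ : Ext N (ModuleCat.of R (QuotSMulTop r M)) rs.length →ₗ[R]
        Ext N (ModuleCat.of R M) (rs.length + 1) := hS.extClass.postcompOfLinear R N rfl
    have hδ : Function.Injective δ := by
      rw [← LinearMap.ker_eq_bot, LinearMap.ker_eq_bot']
      intro x hx
      obtain ⟨y, hy⟩ := Ext.covariant_sequence_exact₃ N hS x (n₁ := rs.length + 1) rfl hx
      rw [← hy, (hvan rs.length (by simp)).elim y 0]
      exact Ext.zero_comp ..
    refine ⟨δ ∘ₗ φ ∘ₗ (LinearEquiv.congrRight e).toLinearMap, ?_⟩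
    exact hδ.comp (hφ.comp (LinearEquiv.congrRight e).injective)

end Shift

/-! ### Duality modulo a parameter ideal -/

section Duality

variable {R : Type u} [CommRing R] [IsLocalRing R]

/-- If the socle of `E` has length at most one, then `Hom(N, E)` is at most as long as `N`. -/
lemma IsFiniteLength.length_linearMap_le (E : Type u) [AddCommGroup E] [Module R E]
    (hE : Module.length R (ResidueField R →ₗ[R] E) ≤ 1) {N : Type u} [AddCommGroup N] [Module R N]
    (hN : IsFiniteLength R N) : Module.length R (N →ₗ[R] E) ≤ Module.length R N := by
  induction hN with
  | @of_subsingleton N _ _ _ => simp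
  | @of_simple_quotient L _ _ N _ _ ih =>
    obtain ⟨e⟩ := IsSimpleModule.nonempty_linearEquiv_residueField (R := R) (L ⧸ N)
    have hQ : Module.length R ((L ⧸ N) →ₗ[R] E) ≤ Module.length R (L ⧸ N) := by
      rw [Module.length_eq_one R (L ⧸ N), (LinearEquiv.congrLeft E R e).length_eq]
      exact hE
    let res : (L →ₗ[R] E) →ₗ[R] (N →ₗ[R] E) := LinearMap.lcomp R E N.subtype
    let inf : ((L ⧸ N) →ₗ[R] E) →ₗ[R] (L →ₗ[R] E) := LinearMap.lcomp R E N.mkQ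
    -- Restriction need not be surjective; left exactness of `Hom` and the length of its range
    -- suffice for the inequality.
    have hexact : Function.Exact inf res.rangeRestrict := by
      intro g
      constructor
      · intro hg
        have hg' : res g = 0 := congrArg Subtype.val hg
        refine ⟨N.liftQ g fun x hx => ?_, ?_⟩
        · exact LinearMap.congr_fun hg' ⟨x, hx⟩
        · ext x
          rfl
      · rintro ⟨h, rfl⟩
        apply Subtype.ext
        ext x
        change h (Submodule.Quotient.mk x.1) = 0
        rw [(Submodule.Quotient.mk_eq_zero N).mpr x.2, map_zero]
    have hinf : Function.Injective inf := fun h h' hh => by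
      ext x
      exact LinearMap.congr_fun hh x
    rw [Module.length_eq_add_of_exact inf res.rangeRestrict hinf res.surjective_rangeRestrict
      hexact, Module.length_eq_add_of_exact N.subtype N.mkQ N.injective_subtype N.mkQ_surjective
      (LinearMap.exact_subtype_mkQ N), add_comm]
    exact add_le_add ((Module.length_le_of_injective _ (Submodule.injective_subtype _)).trans ih) hQ

/-- `E` behaves like the injective hull of the residue field over `R ⧸ K`: its socle has length one
and homomorphisms into `E` from modules of finite length killed by `K` extend. -/
structure IsDualizingModulo (K : Ideal R) (E : Type u) [AddCommGroup E] [Module R E] : Prop where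
  isFiniteLength : IsFiniteLength R E
  nontrivial : Nontrivial E
  le_annihilator : K ≤ Module.annihilator R E
  length_socle_le : Module.length R (ResidueField R →ₗ[R] E) ≤ 1
  exists_extend : ∀ (N : Type u) [AddCommGroup N] [Module R N], IsFiniteLength R N →
    K ≤ Module.annihilator R N → ∀ (N' : Submodule R N) (g : N' →ₗ[R] E),
      ∃ h : N →ₗ[R] E, h ∘ₗ N'.subtype = g

namespace IsDualizingModulo

variable {K : Ideal R} {E : Type u} [AddCommGroup E] [Module R E]

/-- The cyclic module `Rx` maps onto `k`, which embeds in `E`; extend this map from `Rx` to `N`. -/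
lemma exists_apply_ne_zero (hE : IsDualizingModulo K E) {N : Type u} [AddCommGroup N] [Module R N]
    (hN : IsFiniteLength R N) (hK : K ≤ Module.annihilator R N) {x : N} (hx : x ≠ 0) :
    ∃ g : N →ₗ[R] E, g x ≠ 0 := by
  have := hE.nontrivial
  obtain ⟨S, ⟨e⟩⟩ := hE.isFiniteLength.exists_submodule_linearEquiv_residueField
  let T := LinearMap.toSpanSingleton R N x
  have hker : LinearMap.ker T ≤ maximalIdeal R := le_maximalIdeal fun h => hx (by
    have : (1 : R) ∈ LinearMap.ker T := by rw [h]; trivial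
    simpa [T] using this)
  let π : (R ⧸ LinearMap.ker T) →ₗ[R] ResidueField R :=
    (LinearMap.ker T).mapQ (maximalIdeal R) LinearMap.id hker
  let g : LinearMap.range T →ₗ[R] E :=
    S.subtype ∘ₗ e.symm.toLinearMap ∘ₗ π ∘ₗ T.quotKerEquivRange.symm.toLinearMap
  obtain ⟨h, hh⟩ := hE.exists_extend N hN hK (LinearMap.range T) g
  refine ⟨h, fun h0 => ?_⟩
  have hxT : x ∈ LinearMap.range T := ⟨1, by simp [T]⟩
  have h1 : g ⟨x, hxT⟩ = 0 := by rw [← hh]; exact h0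
  have h2 : T.quotKerEquivRange.symm ⟨x, hxT⟩ = Submodule.Quotient.mk 1 := by
    rw [LinearEquiv.symm_apply_eq]
    exact Subtype.ext (one_smul R x).symm
  have h3 : e.symm (π (Submodule.Quotient.mk 1)) = 0 := by
    rw [← h2]
    exact Subtype.ext h1
  rw [LinearEquiv.map_eq_zero_iff] at h3
  exact one_ne_zero (α := ResidueField R) h3

lemma mem_of_forall_smul_eq_zero (hE : IsDualizingModulo K E) (hK : IsFiniteLength R (R ⧸ K))
    {s : R} (hs : ∀ x : E, s • x = 0) : s ∈ K := by
  by_contra hsK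
  obtain ⟨g, hg⟩ := hE.exists_apply_ne_zero hK (Ideal.annihilator_quotient (I := K)).ge
    (x := Ideal.Quotient.mk K s) (by rwa [Ne, Ideal.Quotient.eq_zero_iff_mem])
  apply hg
  have : Ideal.Quotient.mk K s = s • (1 : R ⧸ K) := by
    rw [Algebra.smul_def, mul_one]; rfl
  rw [this, map_smul, hs]

/-- Every endomorphism of a dualizing module is a homothety. -/
lemma exists_eq_smul (hE : IsDualizingModulo K E) (hK : IsFiniteLength R (R ⧸ K))
    (g : E →ₗ[R] E) : ∃ s : R, ∀ x, g x = s • x := by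
  have hKE : ∀ s ∈ K, ∀ x : E, s • x = 0 := fun s hs x =>
    Module.mem_annihilator.mp (hE.le_annihilator hs) x
  let θ : (R ⧸ K) →ₗ[R] (E →ₗ[R] E) := K.liftQ (LinearMap.lsmul R E) fun s hs => by
    ext x
    exact hKE s hs x
  have hθ : Function.Injective θ := by
    rw [← LinearMap.ker_eq_bot, LinearMap.ker_eq_bot']
    intro y hy
    obtain ⟨s, rfl⟩ := Submodule.Quotient.mk_surjective _ y
    rw [Submodule.Quotient.mk_eq_zero]
    exact hE.mem_of_forall_smul_eq_zero hK fun x => LinearMap.congr_fun hy x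
  let ev : E →ₗ[R] ((R ⧸ K) →ₗ[R] E) :=
    { toFun := fun x => K.liftQ (LinearMap.toSpanSingleton R E x) fun s hs => hKE s hs x
      map_add' := fun x y => by
        ext
        exact smul_add (1 : R) x y
      map_smul' := fun c x => by
        ext
        exact smul_comm (1 : R) c x }
  have hev : Function.Injective ev := fun x y h => by
    have h1 : (1 : R) • x = (1 : R) • y := LinearMap.congr_fun h (Submodule.Quotient.mk 1)
    rwa [one_smul, one_smul] at h1
  -- The chain is `ℓ(End E) ≤ ℓ(E) ≤ ℓ(Hom(R/K, E)) ≤ ℓ(R/K)`. The injection `θ : R/K → End E` is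
  -- then onto, all lengths being finite.
  have hlen : Module.length R (E →ₗ[R] E) ≤ Module.length R (R ⧸ K) :=
    (hE.isFiniteLength.length_linearMap_le E hE.length_socle_le).trans <|
      (Module.length_le_of_injective ev hev).trans (hK.length_linearMap_le E hE.length_socle_le)
  have hfin : IsFiniteLength R (E →ₗ[R] E) := by
    rw [← Module.length_ne_top_iff]
    exact ne_top_of_le_ne_top (Module.length_ne_top_iff.mpr hK) hlen
  obtain ⟨_, _⟩ := isFiniteLength_iff_isNoetherian_isArtinian.mp hfin
  have hrange : LinearMap.range θ = ⊤ := by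
    by_contra hne
    have h1 := Submodule.length_lt hne
    have h2 := (LinearEquiv.ofInjective θ hθ).length_eq
    exact absurd (hlen.trans_eq h2) (not_le.mpr h1)
  obtain ⟨y, rfl⟩ := LinearMap.range_eq_top.mp hrange g
  obtain ⟨s, rfl⟩ := Submodule.Quotient.mk_surjective _ y
  exact ⟨s, fun x => rfl⟩

lemma smul_mem_smul_top (hE : IsDualizingModulo K E) (hK : IsFiniteLength R (R ⧸ K))
    {I : Ideal R} {a : R} (ha : a ∈ K.colon (K.colon (I : Set R) : Set R)) (x : E) :
    a • x ∈ I • (⊤ : Submodule R E) := by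
  by_contra hax
  obtain ⟨g, hg⟩ := hE.exists_apply_ne_zero (N := E ⧸ I • (⊤ : Submodule R E))
    (x := Submodule.Quotient.mk (a • x))
    (hE.isFiniteLength.of_surjective (Submodule.mkQ_surjective _))
    (hE.le_annihilator.trans
      (LinearMap.annihilator_le_of_surjective _ (Submodule.mkQ_surjective _)))
    (by rwa [Ne, Submodule.Quotient.mk_eq_zero])
  obtain ⟨s, hs⟩ := hE.exists_eq_smul hK (g ∘ₗ Submodule.mkQ _)
  have hsI : s ∈ K.colon (I : Set R) := Submodule.mem_colon.mpr fun b hb => by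
    refine hE.mem_of_forall_smul_eq_zero hK fun y => ?_
    rw [smul_eq_mul, mul_smul, ← hs]
    have : (I • (⊤ : Submodule R E)).mkQ (b • y) = 0 := by
      rw [Submodule.mkQ_apply, Submodule.Quotient.mk_eq_zero]
      exact Submodule.smul_mem_smul hb trivial
    rw [LinearMap.comp_apply, this, map_zero]
  have has : a * s ∈ K := Submodule.mem_colon.mp ha s hsI
  apply hg
  have h1 : g (Submodule.Quotient.mk (a • x)) = s • a • x := hs (a • x)
  rw [h1, smul_smul, mul_comm]
  exact Module.mem_annihilator.mp (hE.le_annihilator has) x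

end IsDualizingModulo

end Duality

section Trace

variable {R : Type u} [CommRing R]

lemma smul_mem_smul_top_of_quotient {K I : Ideal R} (hI : K ≤ I) {M : Type u} [AddCommGroup M]
    [Module R M] {x : M}
    (h : (Submodule.Quotient.mk x : M ⧸ (K • ⊤ : Submodule R M)) ∈
      (I • ⊤ : Submodule R (M ⧸ (K • ⊤ : Submodule R M)))) : x ∈ (I • ⊤ : Submodule R M) := by
  have hle : (K • ⊤ : Submodule R M) ≤ I • ⊤ := Submodule.smul_mono_left hI
  have h' : (I • ⊤ : Submodule R (M ⧸ (K • ⊤ : Submodule R M))) =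
      (I • ⊤ : Submodule R M).map (Submodule.mkQ _) := by
    rw [Submodule.map_smul'', Submodule.map_top, Submodule.range_mkQ]
  rw [h'] at h
  obtain ⟨y, hy, hyx⟩ := h
  rw [Submodule.mkQ_apply, Submodule.Quotient.eq] at hyx
  exact (Submodule.sub_mem_iff_right _ hy).mp (hle hyx)

/-- Applying `f : M → R` to `ax ∈ IM` gives `a f(x) ∈ I f(M) ⊆ I`. -/
lemma smul_mem_of_mem_traceIdeal {I : Ideal R} {M : Type u} [AddCommGroup M] [Module R M] {a : R}
    (ha : ∀ x : M, a • x ∈ (I • ⊤ : Submodule R M)) {b : R} (hb : b ∈ traceIdeal R M) :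
    a • b ∈ I := by
  have hle : traceIdeal R M ≤ Submodule.comap (LinearMap.lsmul R R a) I := by
    refine Ideal.span_le.mpr ?_
    rintro _ ⟨f, x, rfl⟩
    have hf : (I • ⊤ : Submodule R M).map f ≤ I := by
      rw [Submodule.map_smul'']
      exact Submodule.smul_le.mpr fun r hr n _ => I.mul_mem_right n hr
    have : f (a • x) ∈ I := hf ⟨_, ha x, rfl⟩
    rwa [map_smul] at this
  exact hle hb

/-- If `ω ⧸ K ω` is dualizing modulo `K`, then the trace ideal of `ω` multiplies `K : (K : I)` into
`I`. -/
lemma colon_colon_le_colon_traceIdeal [IsLocalRing R] {K : Ideal R} {ω : Type u} [AddCommGroup ω] [Module R ω]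
    (hE : IsDualizingModulo K (ω ⧸ (K • ⊤ : Submodule R ω))) (hK : IsFiniteLength R (R ⧸ K))
    {I : Ideal R} (hI : K ≤ I) :
    K.colon (K.colon (I : Set R) : Set R) ≤ I.colon (traceIdeal R ω : Set R) := by
  intro a ha
  refine Submodule.mem_colon.mpr fun b hb => ?_
  refine smul_mem_of_mem_traceIdeal (fun x => smul_mem_smul_top_of_quotient hI ?_) hb
  rw [Submodule.Quotient.mk_smul]
  exact hE.smul_mem_smul_top hK ha _

end Trace

/-! ### Canonical modules modulo a system of parameters -/

section CanonicalModule

open Abelian RingTheory.Sequence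

variable {R : Type u} [CommRing R] [IsLocalRing R] [IsNoetherianRing R]

lemma isFiniteLength_quotient_smul_top {K : Ideal R} (hK : K.radical = maximalIdeal R)
    (M : Type*) [AddCommGroup M] [Module R M] [Module.Finite R M] :
    IsFiniteLength R (M ⧸ (K • ⊤ : Submodule R M)) := by
  have hmin : maximalIdeal R ∈ K.minimalPrimes := by
    refine ⟨⟨inferInstance, hK ▸ Ideal.le_radical⟩, fun J ⟨hJ, hle⟩ _ => ?_⟩
    rw [← hK]
    exact hJ.radical_le_iff.mpr hle
  have : IsArtinianRing (R ⧸ K) := quotient_artinian_of_mem_minimalPrimes_of_isLocalRing K hmin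
  have : Module.Finite (R ⧸ K) (M ⧸ (K • ⊤ : Submodule R M)) :=
    Module.Finite.of_restrictScalars_finite R _ _
  have : IsArtinian R (M ⧸ (K • ⊤ : Submodule R M)) :=
    isArtinian_of_surjective_algebraMap (R := R ⧸ K) Ideal.Quotient.mk_surjective
  exact isFiniteLength_iff_isNoetherian_isArtinian.mpr ⟨inferInstance, this⟩

lemma isFiniteLength_quotient {K : Ideal R} (hK : K.radical = maximalIdeal R) :
    IsFiniteLength R (R ⧸ K) :=
  (Submodule.quotEquivOfEq _ _ (by simp)).isFiniteLength (isFiniteLength_quotient_smul_top hK R)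

/-- A maximal Cohen-Macaulay module has depth at least `d = dim R`. -/
lemma IsMaximalCohenMacaulay.subsingleton_ext {M : Type u} [AddCommGroup M] [Module R M]
    (hM : IsMaximalCohenMacaulay R M) {d : ℕ} (hd : ((d : ℕ∞) : WithBot ℕ∞) = ringKrullDim R) :
    ∀ i < d, Subsingleton (Ext (ModuleCat.of R (ResidueField R)) (ModuleCat.of R M) i) := by
  have := hM.finite
  have := hM.nontrivial
  obtain ⟨rs, hmem, hlen, hreg⟩ := hM.exists_isRegular
  have hlen' : rs.length = d := by
    rw [← hd] at hlen
    exact_mod_cast hlen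
  have : Module.Finite R (ResidueField R) :=
    Module.Finite.of_surjective (Algebra.linearMap R (ResidueField R)) residue_surjective
  rw [← hlen']
  refine ModuleCat.subsingleton_ext_of_exists_isRegular (maximalIdeal R)
    (ModuleCat.of R (ResidueField R)) ?_ (ModuleCat.of R M) ?_ rs hmem hreg
  · rw [Module.support_eq_zeroLocus]
    refine PrimeSpectrum.zeroLocus_anti_mono_ideal ?_
    exact (Ideal.annihilator_quotient (I := maximalIdeal R)).ge
  · refine lt_top_iff_ne_top.mpr (Ne.symm ?_)
    exact Submodule.top_ne_ideal_smul_of_le_jacobson_annihilator (maximalIdeal_le_jacobson _)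

/-- A system of parameters is regular on every maximal Cohen-Macaulay module. -/
lemma IsMaximalCohenMacaulay.isWeaklyRegular {M : Type u} [AddCommGroup M] [Module R M]
    (hM : IsMaximalCohenMacaulay R M) {rs : List R}
    (hlen : ((rs.length : ℕ∞) : WithBot ℕ∞) = ringKrullDim R)
    (hrad : (Ideal.ofList rs).radical = maximalIdeal R) : IsWeaklyRegular M rs := by
  have := hM.finite
  refine isWeaklyRegular_of_maximalIdeal_le_radical rs M (hM.subsingleton_ext hlen)
    (fun r hr => ?_) (hrad ▸ Ideal.radical_mono le_sup_right)
  rw [← hrad]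
  exact Ideal.le_radical (Ideal.subset_span hr)

/-- Modulo a system of parameters, a canonical module becomes dualizing. -/
lemma IsCanonicalModule.isDualizingModulo (hCM : IsCohenMacaulayLocal R)
    {ω : Type u} [AddCommGroup ω] [Module R ω] (hω : IsCanonicalModule R ω) {rs : List R}
    (hlen : ((rs.length : ℕ∞) : WithBot ℕ∞) = ringKrullDim R)
    (hrad : (Ideal.ofList rs).radical = maximalIdeal R) :
    IsDualizingModulo (Ideal.ofList rs) (ω ⧸ (Ideal.ofList rs • ⊤ : Submodule R ω)) := by
  have := hω.isMaximalCohenMacaulay.finite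
  have := hω.isMaximalCohenMacaulay.nontrivial
  have hle : Ideal.ofList rs ≤ maximalIdeal R := hrad ▸ Ideal.le_radical
  have hregω := hω.isMaximalCohenMacaulay.isWeaklyRegular hlen hrad
  have hregR : IsRegular R rs :=
    .of_isWeaklyRegular_of_mem_maximalIdeal _ (fun r hr => hle (Ideal.subset_span hr))
      (hCM.isWeaklyRegular hlen hrad)
  have hdepth := hω.isMaximalCohenMacaulay.subsingleton_ext hlen
  have hQ := isFiniteLength_quotient hrad
  have : Nontrivial (R ⧸ Ideal.ofList rs) :=
    Ideal.Quotient.nontrivial_iff.mpr (ne_top_of_le_ne_top (Ideal.IsPrime.ne_top inferInstance) hle)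
  -- The Cohen–Macaulay property of `R` enters here: `rs` is `R`-regular, so `R/K` has projective
  -- dimension `d`. It serves as the finite length module without `Ext` into `ω` above degree `d`.
  have hpd : HasProjectiveDimensionLE (ModuleCat.of R (R ⧸ Ideal.ofList rs)) rs.length := by
    rw [← projectiveDimension_le_iff,
      projectiveDimension_eq_of_iso (Shrink.linearEquiv.{u} R _).symm.toModuleIso,
      ModuleCat.projectiveDimension_quotient_eq_length.{u} rs hregR]
  obtain ⟨n, hn⟩ := hω.finite_injectiveDimension
  have htop : Subsingleton (Ext (ModuleCat.of R (ResidueField R)) (ModuleCat.of R ω)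
      (1 + rs.length)) :=
    subsingleton_ext_residueField_of_lt _ hn hQ
      (fun i hi => HasProjectiveDimensionLT.subsingleton _ (rs.length + 1) i (by omega) _)
      _ (by omega : rs.length < _)
  refine ⟨isFiniteLength_quotient_smul_top hrad ω, ?_, ?_, ?_, fun N _ _ hN hK N' g => ?_⟩
  · rw [Submodule.Quotient.nontrivial_iff]
    exact (Submodule.top_ne_ideal_smul_of_le_jacobson_annihilator
      (hle.trans (maximalIdeal_le_jacobson _))).symm
  · intro r hr
    refine Module.mem_annihilator.mpr fun y => ?_
    obtain ⟨x, rfl⟩ := Submodule.Quotient.mk_surjective _ y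
    rw [← Submodule.Quotient.mk_smul, Submodule.Quotient.mk_eq_zero]
    exact Submodule.smul_mem_smul hr trivial
  · obtain ⟨φ, hφ⟩ := exists_injective_hom_ext rs ω hregω
      (ModuleCat.of R (ResidueField R)) hdepth
    obtain ⟨e⟩ := hω.type_eq_one rs.length hlen
    have hsimple : IsSimpleModule R (ResidueField R) :=
      isSimpleModule_iff_quot_maximal.mpr ⟨maximalIdeal R, inferInstance, ⟨LinearEquiv.refl R _⟩⟩
    refine (Module.length_le_of_injective φ hφ).trans ?_
    rw [e.length_eq, Module.length_eq_one]
  -- The obstruction to lifting a class from `Ext^d(N', ω)` to `Ext^d(N, ω)` lies in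
  -- `Ext^{d+1}(N/N', ω)`, which vanishes by `htop` and dévissage.
  · refine exists_comp_eq_of_ext_surjective rs ω hregω N'.quotientShortComplex.f
      (fun r hr => hK (Ideal.subset_span hr))
      (fun i hi => subsingleton_ext_of_isFiniteLength _ i (hdepth i hi)
        (hN.of_injective N'.injective_subtype)) (fun α => ?_) g
    exact Ext.contravariant_sequence_exact₁ N'.quotientShortComplex_shortExact _ α rfl
      ((subsingleton_ext_of_isFiniteLength _ _ htop
        (hN.of_surjective N'.mkQ_surjective)).elim _ _)

end CanonicalModule

theorem proposition1p1 (R : Type u) [CommRing R] [IsLocalRing R] [IsNoetherianRing R]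
    (hCM : IsCohenMacaulayLocal R) (hk : Infinite (ResidueField R))
    (ω : Type u) [AddCommGroup ω] [Module R ω] (hω : IsCanonicalModule R ω) :
    (maximalIdeal R ≤ traceIdeal R ω →
      ∀ K : Ideal R, IsParameterIdeal K → AlmostDualModulo K) ∧
    ((∀ K : Ideal R, IsParameterIdeal K → AlmostDualModulo K) →
      ∀ Λ : Set (Ideal R), IsAvoidablePrimeSet Λ →
        ∀ K : Ideal R, IsParameterIdeal K → IsGeneralFor Λ K → AlmostDualModulo K) := by
  refine ⟨?_, fun h _ _ K hK _ => h K hK⟩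
  rintro htr _ ⟨d, x, ⟨hd, hrad⟩, rfl⟩ I hI
  have hspan : Ideal.ofList (List.ofFn x) = Ideal.span (Set.range x) := by
    simp [Ideal.ofList, Set.range, List.mem_ofFn]
  rw [← hspan] at hrad hI ⊢
  have hE := hω.isDualizingModulo hCM (by simpa using hd) hrad
  exact (colon_colon_le_colon_traceIdeal hE (isFiniteLength_quotient hrad) hI).trans
    (Submodule.colon_mono le_rfl htr)
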